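/- Notation. $\langle\xi\rangle=(1+|\xi|^2)^{1/2}$, $\widehat u(\xi)=\int e^{-i\langle x,\xi\rangle}u(x)\,dx$ (extended to $\mathcal S'(\mathbb R^n)$ by duality), $\tau_y\chi=\chi(\cdot-y)$. A weight $k\in\mathcal K_{pol}(\mathbb R^n)$ is a positive measurable function on $\mathbb R^n$ for which there are constants $C,N>0$ with $$k(\xi+\eta)\le C\langle\xi\rangle^N k(\eta),\qquad \xi,\eta\in\mathbb R^n. \tag{1}$$ For $v\in\mathcal S'(\mathbb R^n)$ such that $\widehat v$ is a function put $\|v\|_{\mathcal B_k}=\|k\widehat v\|_{L^2}$ (and $\|v\|_{\mathcal B_k}=\infty$ if $\widehat v$ is not a function). For $1\le p\le\infty$, $u\in\mathcal D'(\mathbb R^n)$ and $\chi\in C_0^\infty(\mathbb R^n)\setminus 0$ put $$\|u\|_{k,p,\chi}=\Big(\int\|u\,\tau_y\chi\|_{\mathcal B_k}^p\,dy\Big)^{1/p}\ (p<\infty),\qquad \|u\|_{k,\infty,\chi}=\sup_y\|u\,\tau_y\chi\|_{\mathcal B_k};$$ $u$ belongs to $\mathcal B_k^p(\mathbb R^n)$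 if for some $\chi\in C_0^\infty\setminus 0$ the function $y\mapsto\|u\,\tau_y\chi\|_{\mathcal B_k}$ belongs to $L^p$. Let $$U_{\chi,p}(\xi)=\Big(\int|\widehat{u\tau_y\chi}(\xi)|^p\,dy\Big)^{1/p}\ (p<\infty),\qquad U_{\chi,\infty}(\xi)=\sup_y|\widehat{u\tau_y\chi}(\xi)|,$$ where $\widehat{u\tau_y\chi}(\xi)=\langle u,e^{-i\langle\cdot,\xi\rangle}\chi(\cdot-y)\rangle$; $u$ belongs to $S_w^p(\mathbb R^n)$ if $U_{\chi,p}\in L^1(\mathbb R^n)$ for some $\chi\in C_0^\infty\setminus 0$, and $\|u\|_{S_w^p,\chi}=\|U_{\chi,p}\|_{L^1}$. (The topologies of $\mathcal B_k^p$ and $S_w^p$ given by these norms do not depend on $\chi$.) Finally $\|\chi\|_{H^N}=\|\langle\cdot\rangle^N\widehat\chi\|_{L^2}$. Theorem. Let $k\in\mathcal K_{pol}(\mathbb R^n)$ with $1/k\in L^1(\mathbb R^n)$ and let $1\le p\le\infty$. Then $\mathcal B_k^p(\mathbb R^n)\hookrightarrow S_w^p(\mathbb R^n)$ continuously, that is,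 $\mathcal B_k^p(\mathbb R^n)\subset S_w^p(\mathbb R^n)$ and for all $\chi,\widetilde\chi\in C_0^\infty(\mathbb R^n)\setminus 0$ there is a finite constant $A$ with $\|u\|_{S_w^p,\chi}\le A\|u\|_{k,p,\widetilde\chi}$ for all $u\in\mathcal B_k^p(\mathbb R^n)$. Moreover, if $C,N>0$ are any constants for which (1) holds, and $\chi,\widetilde\chi\in C_0^\infty(\mathbb R^n)\setminus 0$ satisfy $\widetilde\chi=1$ on $\operatorname{supp}\chi$, then $$\|u\|_{S_w^p,\chi}\le(2\pi)^{-n}\,C\,\|\chi\|_{H^N}\,\|1/k\|_{L^1}\,\|u\|_{k,p,\widetilde\chi},\qquad u\in\mathcal B_k^p(\mathbb R^n).$$ -/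

import Mathlib

open MeasureTheory TopologicalSpace SchwartzMap
open scoped ENNReal Distributions FourierTransform

noncomputable section

namespace KatoSobolev

/-- The Euclidean space `ℝⁿ`. -/
abbrev Rn (n : ℕ) : Type := EuclideanSpace ℝ (Fin n)

/-- `C₀^∞(ℝⁿ)`: complex-valued smooth functions with compact support, with the usual LF topology. -/
abbrev Test (n : ℕ) : Type := 𝓓((⊤ : Opens (Rn n)), ℂ)

/-- `𝓓'(ℝⁿ)`: continuous complex-linear forms on `C₀^∞(ℝⁿ)`. -/
abbrev Distr (n : ℕ) : Type := Test n →L[ℂ] ℂ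

variable {n : ℕ}

/-- `⟨ξ⟩ = (1 + |ξ|²)^{1/2}`. -/
def bracket (ξ : Rn n) : ℝ := (1 + ‖ξ‖ ^ 2) ^ (1 / 2 : ℝ)

/-- `C, N` are positive constants that define the weight `k`:
`k(ξ + η) ≤ C ⟨ξ⟩^N k(η)` for all `ξ, η`. -/
def IsWeightBound (k : Rn n → ℝ) (C N : ℝ) : Prop :=
  0 < C ∧ 0 < N ∧ ∀ ξ η : Rn n, k (ξ + η) ≤ C * bracket ξ ^ N * k η

/-- The class `K_pol(ℝⁿ)` of weight functions of polynomial growth: positive (Lebesgue) measurable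
functions that admit constants as in `IsWeightBound`. -/
def IsPolWeight (k : Rn n → ℝ) : Prop :=
  AEMeasurable k volume ∧ (∀ ξ, 0 < k ξ) ∧ ∃ C N : ℝ, IsWeightBound k C N

/-! ### The Fourier transform, normalised by `û(ξ) = ∫ e^{-i⟨x,ξ⟩} u(x) dx` -/

/-- The dilation `x ↦ x / (2π)` of `ℝⁿ`. -/
def dilation : Rn n ≃L[ℝ] Rn n :=
  ContinuousLinearEquiv.smulLeft
    (Units.mk0 ((2 * Real.pi)⁻¹ : ℝ) (inv_ne_zero Real.two_pi_pos.ne'))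

/-- The Fourier transform on `𝓢(ℝⁿ)`: Mathlib's one, `∫ e^{-2πi⟨x,ξ⟩} φ(x) dx`, evaluated
at `ξ / (2π)`; see `hat_apply`. -/
def hat : 𝓢(Rn n, ℂ) →L[ℂ] 𝓢(Rn n, ℂ) :=
  (SchwartzMap.compCLMOfContinuousLinearEquiv ℂ dilation).comp
    (FourierTransform.fourierCLM ℂ 𝓢(Rn n, ℂ))

theorem hat_apply (φ : 𝓢(Rn n, ℂ)) (ξ : Rn n) :
    hat φ ξ = ∫ x, Complex.exp (-(Complex.I * (inner ℝ x ξ : ℝ))) * φ x := by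
  have h : hat φ ξ = 𝓕 (φ : Rn n → ℂ) ((2 * Real.pi)⁻¹ • ξ) := rfl
  rw [h, Real.fourier_eq']
  refine integral_congr_ae (Filter.Eventually.of_forall fun x => ?_)
  simp only [smul_eq_mul, inner_smul_right]
  congr 2
  have : (Real.pi : ℂ) ≠ 0 := by exact_mod_cast Real.pi_ne_zero
  push_cast
  field_simp

/-- The Fourier transform on `𝓢'(ℝⁿ)`: `⟨v̂, φ⟩ = ⟨v, φ̂⟩`. -/
def hatDist (v : 𝓢'(Rn n, ℂ)) : 𝓢'(Rn n, ℂ) :=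
  PointwiseConvergenceCLM.precomp ℂ hat v

/-- The tempered distribution `T` is (given by) the locally integrable function `g`. -/
def IsGivenBy (T : 𝓢'(Rn n, ℂ)) (g : Rn n → ℂ) : Prop :=
  LocallyIntegrable g volume ∧
    ∀ φ : 𝓢(Rn n, ℂ), HasCompactSupport φ → T φ = ∫ ξ, g ξ * φ ξ

/-- The norm `‖v‖_{q,k} = ‖k v̂‖_{L^q}` of the space `B_{q,k}(ℝⁿ)`, for arbitrary `v ∈ 𝓢'(ℝⁿ)`;
it is `∞` if `v̂` is not a function. (The function `v̂` is unique up to null sets.) -/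
def bNorm (q : ℝ≥0∞) (k : Rn n → ℝ) (v : 𝓢'(Rn n, ℂ)) : ℝ≥0∞ :=
  ⨅ (g : Rn n → ℂ) (_ : IsGivenBy (hatDist v) g), eLpNorm (fun ξ => (k ξ : ℂ) * g ξ) q volume

/-- The norm of the Hilbert space `𝓑_k(ℝⁿ) = B_{2,k}(ℝⁿ)`. -/
def calBNorm (k : Rn n → ℝ) (v : 𝓢'(Rn n, ℂ)) : ℝ≥0∞ := bNorm 2 k v

/-! ### Operations on test functions and distributions -/

/-- The translate `τ_y χ = χ(· - y)`. -/
def translateTest (y : Rn n) (χ : Test n) : Test n where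
  toFun x := χ (x - y)
  contDiff' := χ.contDiff.comp (contDiff_id.sub contDiff_const)
  hasCompactSupport' := χ.hasCompactSupport.comp_homeomorph (Homeomorph.subRight y)
  tsupport_subset' := Set.subset_univ _

/-- The test function `x ↦ e^{-i⟨x,ξ⟩} χ(x)`. -/
def modulate (ξ : Rn n) (χ : Test n) : Test n where
  toFun x := Complex.exp (-(Complex.I * (inner ℝ x ξ : ℝ))) * χ x
  contDiff' := by
    refine ContDiff.mul ?_ χ.contDiff
    refine ContDiff.cexp (ContDiff.neg (contDiff_const.mul ?_))
    exact Complex.ofRealCLM.contDiff.comp (contDiff_id.inner ℝ contDiff_const)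
  hasCompactSupport' := χ.hasCompactSupport.mul_left
  tsupport_subset' := Set.subset_univ _

/-- The support of a test function as a bundled compact set. -/
def testSupport (χ : Test n) : Compacts (Rn n) := ⟨tsupport χ, χ.hasCompactSupport⟩

/-- Multiplication by a test function `χ`, from `𝓢(ℝⁿ)` to the smooth functions supported in
`supp χ`. -/
def mulTestLM (χ : Test n) : 𝓢(Rn n, ℂ) →ₗ[ℂ] 𝓓_{testSupport χ}(Rn n, ℂ) where
  toFun φ := ContDiffMapSupportedIn.of_support_subset (f := fun x => χ x * φ x)
    (χ.contDiff.mul (φ.smooth ⊤))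
    ((Function.support_mul_subset_left _ _).trans (subset_tsupport _))
  map_add' φ ψ := by
    ext x
    exact mul_add _ _ _
  map_smul' c φ := by
    ext x
    exact mul_left_comm _ _ _

theorem continuous_mulTestLM (χ : Test n) : Continuous (mulTestLM χ) := by
  have hχ : Function.HasTemperateGrowth (χ : Rn n → ℂ) :=
    χ.hasCompactSupport.hasTemperateGrowth χ.contDiff
  refine WithSeminorms.continuous_of_continuous_comp
    (ContDiffMapSupportedIn.withSeminorms ℂ (Rn n) ℂ ⊤ (testSupport χ)) _ fun i => ?_
  have hc : Continuous ((SchwartzMap.seminorm ℂ 0 i).comp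
      (SchwartzMap.smulLeftCLM ℂ (χ : Rn n → ℂ)).toLinearMap : Seminorm ℂ 𝓢(Rn n, ℂ)) :=
    ((schwartz_withSeminorms ℂ (Rn n) ℂ).continuous_seminorm (0, i)).comp
      (SchwartzMap.smulLeftCLM ℂ (χ : Rn n → ℂ)).continuous
  refine Seminorm.continuous_of_le hc fun φ => ?_
  refine (ContDiffMapSupportedIn.seminorm_top_le_iff ℂ (apply_nonneg _ _) i _).2 fun x hx => ?_
  have h := SchwartzMap.norm_iteratedFDeriv_le_seminorm ℂ
    (SchwartzMap.smulLeftCLM ℂ (χ : Rn n → ℂ) φ) i x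
  have he : ((SchwartzMap.smulLeftCLM ℂ (χ : Rn n → ℂ) φ : 𝓢(Rn n, ℂ)) : Rn n → ℂ) =
      mulTestLM χ φ := by
    ext x
    exact SchwartzMap.smulLeftCLM_apply_apply hχ φ x
  rw [he] at h
  exact h

/-- The product `u χ`, as a tempered distribution: `⟨u χ, φ⟩ = ⟨u, χ φ⟩`. -/
def mulTest (u : Distr n) (χ : Test n) : 𝓢'(Rn n, ℂ) :=
  ContinuousLinearMap.toPointwiseConvergenceCLM ℂ (RingHom.id ℂ) 𝓢(Rn n, ℂ) ℂ
    ((u.comp (TestFunction.ofSupportedInCLM ℂ (Set.subset_univ _))).comp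
      (⟨mulTestLM χ, continuous_mulTestLM χ⟩ : 𝓢(Rn n, ℂ) →L[ℂ] 𝓓_{testSupport χ}(Rn n, ℂ)))

/-! ### The spaces `𝓑_k^p(ℝⁿ)` and `S_w^p(ℝⁿ)` -/

/-- `(∫ f(y)^p dy)^{1/p}` if `p < ∞`, and `sup_y f(y)` if `p = ∞`. -/
def mixedNorm (p : ℝ≥0∞) (f : Rn n → ℝ≥0∞) : ℝ≥0∞ :=
  if p = ∞ then ⨆ y, f y else (∫⁻ y, f y ^ p.toReal) ^ (1 / p.toReal)

/-- The function `y ↦ ‖u τ_y χ‖_{𝓑_k}`. -/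
def localNorm (k : Rn n → ℝ) (u : Distr n) (χ : Test n) (y : Rn n) : ℝ≥0∞ :=
  calBNorm k (mulTest u (translateTest y χ))

/-- `u ∈ 𝓑_k^p(ℝⁿ)`: there is `χ ∈ C₀^∞ ∖ 0` such that `y ↦ ‖u τ_y χ‖_{𝓑_k}` belongs to `L^p`. -/
def MemB (k : Rn n → ℝ) (p : ℝ≥0∞) (u : Distr n) : Prop :=
  ∃ χ : Test n, χ ≠ 0 ∧ MemLp (localNorm k u χ) p volume

/-- The norm `‖u‖_{k,p,χ}`. -/
def normB (k : Rn n → ℝ) (p : ℝ≥0∞) (χ : Test n) (u : Distr n) : ℝ≥0∞ :=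
  mixedNorm p (localNorm k u χ)

/-- The function `U_{χ,p}(ξ)`, the `L^p` norm in `y` of
`(u τ_y χ)^(ξ) = ⟨u, e^{-i⟨·,ξ⟩} χ(· - y)⟩`. -/
def bigU (p : ℝ≥0∞) (u : Distr n) (χ : Test n) (ξ : Rn n) : ℝ≥0∞ :=
  mixedNorm p fun y => ‖u (modulate ξ (translateTest y χ))‖ₑ

/-- `u ∈ S_w^p(ℝⁿ)`: there is `χ ∈ C₀^∞ ∖ 0` such that `U_{χ,p}` belongs to `L¹`. -/
def MemSw (p : ℝ≥0∞) (u : Distr n) : Prop :=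
  ∃ χ : Test n, χ ≠ 0 ∧ MemLp (bigU p u χ) 1 volume

/-- The norm `‖u‖_{S_w^p,χ} = ‖U_{χ,p}‖_{L¹}`. -/
def normSw (p : ℝ≥0∞) (χ : Test n) (u : Distr n) : ℝ≥0∞ := ∫⁻ ξ, bigU p u χ ξ

/-- The Sobolev norm `‖χ‖_{H^s} = ‖⟨·⟩^s χ̂‖_{L²}` of a test function. -/
def sobolevNorm (s : ℝ) (χ : Test n) : ℝ≥0∞ :=
  eLpNorm (fun ξ : Rn n => ((bracket ξ ^ s : ℝ) : ℂ) * ∫ x, modulate ξ χ x) 2 volume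

end KatoSobolev

end

open KatoSobolev

open MeasureTheory TopologicalSpace SchwartzMap Filter Topology
open scoped ENNReal Distributions FourierTransform ContDiff

noncomputable section

namespace KatoSobolev

variable {n : ℕ}

/-! If a window factors as `χ = φ · τ_a χ'`, then `u τ_y χ = (τ_y φ)(u τ_{y+a} χ')`, so its Fourier
transform is `(2π)^{-n}` times the convolution of the transforms of the two factors. Since `k(ξ) ≤
C⟨ξ-η⟩^N k(η)`, Cauchy–Schwarz in `η` bounds `k(ξ)` times its modulus by `(2π)^{-n} C ‖φ‖_{H^N} ‖u
τ_{y+a} χ'‖_{𝓑_k}` (`enorm_modulate_le_localNorm`). Taking the `L^p` norm in `y`, which ignores the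
shift by `a`, and integrating `1/k` over `ξ` gives `normSw_le_of_eq_mul`.

If `χ' = 1` on `supp χ`, the choice `φ = χ`, `a = 0` gives the explicit constant. For arbitrary
windows, `exists_eq_sum_mulTranslate` writes `χ` as a finite sum of such products and Minkowski's
inequality adds up the bounds. -/

/-! ### Tempered distributions given by functions. -/

/-- Compactly supported cutoffs of a Schwartz function converge to it in the Schwartz space. -/
theorem exists_tendsto_hasCompactSupport (θ : 𝓢(Rn n, ℂ)) :
    ∃ f : ℕ → 𝓢(Rn n, ℂ), (∀ m, HasCompactSupport (f m)) ∧
      (∀ m x, ‖f m x‖ ≤ ‖θ x‖) ∧ Tendsto f atTop (𝓝 θ) := by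
  let b : ContDiffBump (0 : Rn n) := ⟨1, 2, one_pos, one_lt_two⟩
  let β : Rn n → ℂ := fun x => (b x : ℂ)
  have hβ : ContDiff ℝ ∞ β := Complex.ofRealCLM.contDiff.comp b.contDiff
  have hβc : HasCompactSupport β := b.hasCompactSupport.comp_left (g := Complex.ofReal) rfl
  let r : ℕ → ℝ := fun m => ((m : ℝ) + 1)⁻¹
  have hr0 : ∀ m, 0 < r m := fun m => by positivity
  have hr1 : ∀ m, r m ≤ 1 := fun m => inv_le_one_of_one_le₀ (by simp)
  have hs : ∀ m, ContDiff ℝ ∞ fun x => β (r m • x) := fun m =>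
    hβ.comp (contDiff_const_smul (r m))
  have hsc : ∀ m, HasCompactSupport fun x => β (r m • x) := fun m =>
    hβc.comp_homeomorph (Homeomorph.smulOfNeZero (r m) (hr0 m).ne')
  have hsT : ∀ m, Function.HasTemperateGrowth fun x => β (r m • x) := fun m =>
    (hsc m).hasTemperateGrowth (hs m)
  let f : ℕ → 𝓢(Rn n, ℂ) := fun m => SchwartzMap.smulLeftCLM ℂ (fun x => β (r m • x)) θ
  have hf : ∀ m x, f m x = β (r m • x) * θ x := fun m x =>
    SchwartzMap.smulLeftCLM_apply_apply (hsT m) θ x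
  -- Each derivative of `β(r m • ·)` produces a factor `r m ≤ 1`, so the bounds are uniform in `m`;
  -- the summand `1` in the witness covers the constant function when `i = 0`.
  have hD : ∀ i, ∃ M : ℝ, 0 ≤ M ∧ ∀ m x, ‖iteratedFDeriv ℝ i (fun x => 1 - β (r m • x)) x‖ ≤ M := by
    intro i
    obtain ⟨M, hM0, hM⟩ := (hβc.toSchwartzMap hβ).decay 0 i
    have hγ : ContDiff ℝ ∞ fun x => 1 - β x := contDiff_const.sub hβ
    refine ⟨1 + M, by positivity, fun m x => ?_⟩
    have hi : (i : WithTop ℕ∞) ≤ (∞ : WithTop ℕ∞) := by exact_mod_cast le_top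
    rw [congrFun (iteratedFDeriv_comp_const_smul (𝕜 := ℝ) (f := fun x => 1 - β x) (r m)
      (hγ.of_le hi)) x, norm_smul]
    refine (mul_le_of_le_one_left (norm_nonneg _) ?_).trans ?_
    · rw [norm_pow, Real.norm_of_nonneg (hr0 m).le]
      exact pow_le_one₀ (hr0 m).le (hr1 m)
    rw [fun_iteratedFDeriv_sub_apply (contDiff_const.contDiffAt) (hβ.of_le hi).contDiffAt]
    refine (norm_sub_le _ _).trans (add_le_add ?_ ?_)
    · rcases eq_or_ne i 0 with rfl | h0
      · simp
      · simp [iteratedFDeriv_const_of_ne h0]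
    · have := hM (r m • x)
      rw [pow_zero, one_mul] at this
      exact this
  refine ⟨f, fun m => ?_, fun m x => ?_, ?_⟩
  · have : (f m : Rn n → ℂ) = (fun x => β (r m • x)) * θ := funext fun x => hf m x
    rw [this]
    exact (hsc m).mul_right
  · rw [hf, norm_mul]
    refine mul_le_of_le_one_left (norm_nonneg _) ?_
    simpa [β, abs_of_nonneg b.nonneg] using b.le_one
  · rw [(schwartz_withSeminorms ℂ (Rn n) ℂ).tendsto_nhds]
    rintro ⟨j, l⟩ ε hε
    choose M hM0 hM using hD
    let A : ℝ := ∑ i ∈ Finset.range (l + 1),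
      (l.choose i : ℝ) * M i * SchwartzMap.seminorm ℂ (j + 1) (l - i) θ
    have hA : 0 ≤ A := Finset.sum_nonneg fun i _ =>
      mul_nonneg (mul_nonneg (Nat.cast_nonneg _) (hM0 i)) (apply_nonneg _ _)
    -- The remainder vanishes where `r m * ‖x‖ < 1`; elsewhere one more power of `‖x‖` is affordable
    -- and yields the factor `r m`.
    have key : ∀ m, SchwartzMap.seminorm ℂ j l (f m - θ) ≤ r m * A := by
      intro m
      rw [← map_neg_eq_map, neg_sub]
      refine SchwartzMap.seminorm_le_bound ℂ j l _ (mul_nonneg (hr0 m).le hA) fun x => ?_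
      have he : ((θ - f m : 𝓢(Rn n, ℂ)) : Rn n → ℂ) = fun x => (1 - β (r m • x)) * θ x := by
        ext x
        simp [hf, sub_mul]
      rw [he]
      by_cases hx : ‖r m • x‖ < 1
      · have : (fun x => (1 - β (r m • x)) * θ x) =ᶠ[𝓝 x] fun _ => 0 := by
          have hc : Continuous fun z : Rn n => ‖r m • z‖ := by fun_prop
          filter_upwards [hc.continuousAt.eventually_lt continuousAt_const hx] with z hz
          have : b (r m • z) = 1 := b.one_of_mem_closedBall (by simpa using hz.le)
          simp [β, this]
        rw [(this.iteratedFDeriv ℝ l).eq_of_nhds]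
        simpa using mul_nonneg (hr0 m).le hA
      · have hx1 : 1 ≤ r m * ‖x‖ := by
          simpa [norm_smul, abs_of_pos (hr0 m)] using not_lt.1 hx
        have h1 := norm_iteratedFDeriv_mul_le (𝕜 := ℝ) (N := ∞) (contDiff_const.sub (hs m)) (θ.smooth ⊤) x
          (n := l) (by exact_mod_cast le_top) (f := fun x => 1 - β (r m • x))
        refine (mul_le_mul_of_nonneg_left h1 (by positivity)).trans ?_
        rw [Finset.mul_sum, Finset.mul_sum]
        refine Finset.sum_le_sum fun i _ => ?_
        have h2 := SchwartzMap.le_seminorm ℂ (j + 1) (l - i) θ x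
        have h3 : ‖x‖ ^ j * ‖iteratedFDeriv ℝ (l - i) θ x‖ ≤
            r m * SchwartzMap.seminorm ℂ (j + 1) (l - i) θ :=
          calc ‖x‖ ^ j * ‖iteratedFDeriv ℝ (l - i) θ x‖
            _ ≤ (r m * ‖x‖) * (‖x‖ ^ j * ‖iteratedFDeriv ℝ (l - i) θ x‖) :=
              le_mul_of_one_le_left (by positivity) hx1
            _ = r m * (‖x‖ ^ (j + 1) * ‖iteratedFDeriv ℝ (l - i) θ x‖) := by ring
            _ ≤ _ := mul_le_mul_of_nonneg_left h2 (hr0 m).le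
        calc ‖x‖ ^ j * ((l.choose i : ℝ) * ‖iteratedFDeriv ℝ i (fun x => 1 - β (r m • x)) x‖ *
              ‖iteratedFDeriv ℝ (l - i) θ x‖)
          _ = (l.choose i : ℝ) * ‖iteratedFDeriv ℝ i (fun x => 1 - β (r m • x)) x‖ *
              (‖x‖ ^ j * ‖iteratedFDeriv ℝ (l - i) θ x‖) := by ring
          _ ≤ (l.choose i : ℝ) * M i * (r m * SchwartzMap.seminorm ℂ (j + 1) (l - i) θ) :=
            mul_le_mul (mul_le_mul_of_nonneg_left (hM i m x) (Nat.cast_nonneg _)) h3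
              (by positivity) (mul_nonneg (Nat.cast_nonneg _) (hM0 i))
          _ = _ := by ring
    have hlim : Tendsto (fun m => r m * A) atTop (𝓝 0) := by
      simpa [r] using (tendsto_one_div_add_atTop_nhds_zero_nat (𝕜 := ℝ)).mul_const A
    filter_upwards [hlim.eventually_lt_const hε] with m hm
    exact (key m).trans_lt hm

/-- The integral formula is only known for compactly supported `φ`, and `g θ` need not be
integrable. Cutoffs dominated by `|θ|` still give the upper bound in the limit. -/
theorem IsGivenBy.enorm_apply_le {T : 𝓢'(Rn n, ℂ)} {g : Rn n → ℂ} (h : IsGivenBy T g)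
    (θ : 𝓢(Rn n, ℂ)) : ‖T θ‖ₑ ≤ ∫⁻ ξ, ‖g ξ‖ₑ * ‖θ ξ‖ₑ := by
  obtain ⟨f, hfc, hf, hlim⟩ := exists_tendsto_hasCompactSupport θ
  have hT : Tendsto (fun m => ‖T (f m)‖ₑ) atTop (𝓝 ‖T θ‖ₑ) :=
    (((map_continuous T).tendsto θ).comp hlim).enorm
  refine le_of_tendsto' hT fun m => ?_
  rw [h.2 _ (hfc m)]
  refine (enorm_integral_le_lintegral_enorm _).trans (lintegral_mono fun ξ => ?_)
  rw [enorm_mul]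
  gcongr
  exact enorm_le_iff_norm_le.2 (hf m ξ)

/-! ### Fourier transforms and Sobolev norms of test functions. -/

/-- A test function, regarded as a Schwartz function. -/
def testToSchwartz (χ : Test n) : 𝓢(Rn n, ℂ) := χ.hasCompactSupport.toSchwartzMap χ.contDiff

@[simp]
theorem testToSchwartz_apply (χ : Test n) (x : Rn n) : testToSchwartz χ x = χ x := rfl

theorem modulate_apply (ξ : Rn n) (χ : Test n) (x : Rn n) :
    modulate ξ χ x = Complex.exp (-(Complex.I * (inner ℝ x ξ : ℝ))) * χ x := rfl

theorem translateTest_apply (y : Rn n) (χ : Test n) (x : Rn n) :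
    translateTest y χ x = χ (x - y) := rfl

theorem hat_testToSchwartz (χ : Test n) (ξ : Rn n) :
    hat (testToSchwartz χ) ξ = ∫ x, modulate ξ χ x := hat_apply _ _

theorem hat_injective : Function.Injective (hat : 𝓢(Rn n, ℂ) → 𝓢(Rn n, ℂ)) := by
  intro φ ψ h
  have h' : 𝓕 φ = 𝓕 ψ := by
    ext ξ
    have := congrArg (fun f : 𝓢(Rn n, ℂ) => f (dilation.symm ξ)) h
    simpa [hat] using this
  simpa using congrArg 𝓕⁻ h'

/-- The inverse Fourier transform of a modulated test function. -/
theorem exists_hat_eq_modulate (ψ : Test n) (ξ : Rn n) :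
    ∃ θ : 𝓢(Rn n, ℂ), hat θ = testToSchwartz (modulate ξ ψ) ∧
      ∀ η, θ η = ((2 * Real.pi) ^ (-(n : ℝ)) : ℝ) * ∫ x, modulate (ξ - η) ψ x := by
  refine ⟨𝓕⁻ (SchwartzMap.compCLMOfContinuousLinearEquiv ℂ dilation.symm
    (testToSchwartz (modulate ξ ψ))), ?_, fun η => ?_⟩
  · ext x
    simp [hat]
  · have hd : ∀ x : Rn n, dilation.symm x = (2 * Real.pi) • x := fun x => by
      rw [ContinuousLinearEquiv.symm_apply_eq]
      change x = (2 * Real.pi)⁻¹ • _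
      rw [inv_smul_smul₀ Real.two_pi_pos.ne']
    rw [SchwartzMap.fourierInv_coe, Real.fourierInv_eq']
    -- Rescaling by `2π` to undo `dilation` is the source of the factor `(2π)^{-n}`.
    have := Measure.integral_comp_smul_of_nonneg (volume : Measure (Rn n))
      (fun x => modulate (ξ - η) ψ x) (2 * Real.pi) (hR := Real.two_pi_pos.le)
    rw [Real.rpow_neg Real.two_pi_pos.le, Real.rpow_natCast, ← Complex.real_smul]
    rw [finrank_euclideanSpace_fin] at this
    rw [← this]
    refine integral_congr_ae (Eventually.of_forall fun x => ?_)
    simp only [SchwartzMap.compCLMOfContinuousLinearEquiv_apply, Function.comp_apply, hd,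
      testToSchwartz_apply, modulate_apply, smul_eq_mul, ← mul_assoc, ← Complex.exp_add]
    congr 2
    simp only [inner_smul_left, inner_sub_right]
    push_cast
    simp
    ring

theorem bracket_pos (ξ : Rn n) : 0 < bracket ξ := Real.rpow_pos_of_pos (by positivity) _

theorem bracket_rpow (ξ : Rn n) (s : ℝ) : bracket ξ ^ s = (1 + ‖ξ‖ ^ 2) ^ (s / 2) := by
  rw [bracket, ← Real.rpow_mul (by positivity)]
  ring_nf

/-- The integrand of the Sobolev norm of a test function is a Schwartz function. -/
theorem exists_schwartz_sobolev (s : ℝ) (χ : Test n) :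
    ∃ f : 𝓢(Rn n, ℂ), ∀ ξ, f ξ = ((bracket ξ ^ s : ℝ) : ℂ) * ∫ x, modulate ξ χ x := by
  refine ⟨SchwartzMap.smulLeftCLM ℂ (fun ξ : Rn n => (1 + ‖ξ‖ ^ 2) ^ (s / 2))
    (hat (testToSchwartz χ)), fun ξ => ?_⟩
  rw [SchwartzMap.smulLeftCLM_apply_apply
    (Function.hasTemperateGrowth_one_add_norm_sq_rpow (Rn n) (s / 2)), bracket_rpow,
    hat_testToSchwartz, Complex.real_smul]

theorem sobolevNorm_ne_top (s : ℝ) (χ : Test n) : sobolevNorm s χ ≠ ⊤ := by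
  obtain ⟨f, hf⟩ := exists_schwartz_sobolev s χ
  rw [sobolevNorm, ← funext hf]
  exact (f.memLp 2 volume).eLpNorm_ne_top

theorem eq_zero_of_sobolevNorm_eq_zero {s : ℝ} {χ : Test n} (h : sobolevNorm s χ = 0) : χ = 0 := by
  obtain ⟨f, hf⟩ := exists_schwartz_sobolev s χ
  rw [sobolevNorm, ← funext hf, eLpNorm_eq_zero_iff f.continuous.aestronglyMeasurable two_ne_zero,
    f.continuous.ae_eq_iff_eq volume continuous_zero] at h
  have h0 : hat (testToSchwartz χ) = hat 0 := by
    ext ξ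
    have h1 := hf ξ
    rw [h, Pi.zero_apply, eq_comm, mul_eq_zero, Complex.ofReal_eq_zero] at h1
    rw [hat_testToSchwartz, map_zero]
    exact h1.resolve_left (Real.rpow_pos_of_pos (bracket_pos ξ) s).ne'
  ext x
  exact congrArg (fun f : 𝓢(Rn n, ℂ) => f x) (hat_injective h0)

theorem enorm_integral_modulate_translateTest (ξ y : Rn n) (χ : Test n) :
    ‖∫ x, modulate ξ (translateTest y χ) x‖ₑ = ‖∫ x, modulate ξ χ x‖ₑ := by
  have h : ∫ x, modulate ξ (translateTest y χ) x =
      Complex.exp (-(Complex.I * (inner ℝ y ξ : ℝ))) * ∫ x, modulate ξ χ x := by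
    rw [← integral_add_right_eq_self _ y, ← integral_const_mul]
    refine integral_congr_ae (Eventually.of_forall fun x => ?_)
    simp only [modulate_apply, translateTest_apply, add_sub_cancel_right, inner_add_left,
      ← mul_assoc, ← Complex.exp_add]
    push_cast
    ring_nf
  have h1 : ‖Complex.exp (-(Complex.I * (inner ℝ y ξ : ℝ)))‖ₑ = 1 := by
    rw [← ofReal_norm, Complex.norm_exp]
    simp
  rw [h, enorm_mul, h1, one_mul]

/-! ### The pointwise estimate of the local Fourier transform. -/

theorem lintegral_enorm_mul_le (f g : Rn n → ℂ) (hf : AEStronglyMeasurable f volume)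
    (hg : AEStronglyMeasurable g volume) :
    ∫⁻ x, ‖f x‖ₑ * ‖g x‖ₑ ≤ eLpNorm f 2 volume * eLpNorm g 2 volume := by
  have := eLpNorm_smul_le_mul_eLpNorm (p := 2) (q := 2) (r := 1) hg hf
  rw [eLpNorm_one_eq_lintegral_enorm] at this
  simpa [enorm_mul] using this

/-- Splitting off a factor of the window turns the local Fourier transform into a convolution,
which the weight condition and the Cauchy–Schwarz inequality estimate. -/
theorem IsGivenBy.enorm_modulate_le {k : Rn n → ℝ} (hkm : AEMeasurable k volume)
    (hk0 : ∀ ξ, 0 < k ξ) {C N : ℝ} (hCN : IsWeightBound k C N) {v : 𝓢'(Rn n, ℂ)} {g : Rn n → ℂ}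
    (hg : IsGivenBy (hatDist v) g) (φ : Test n) (y ξ : Rn n) :
    ‖v (testToSchwartz (modulate ξ (translateTest y φ)))‖ₑ ≤
      ENNReal.ofReal ((2 * Real.pi) ^ (-(n : ℝ)) * C) * sobolevNorm N φ *
        ENNReal.ofReal (1 / k ξ) * eLpNorm (fun η => (k η : ℂ) * g η) 2 volume := by
  obtain ⟨θ, hθ, hθ'⟩ := exists_hat_eq_modulate (translateTest y φ) ξ
  obtain ⟨f, hf⟩ := exists_schwartz_sobolev N φ
  have hpi : (0 : ℝ) ≤ (2 * Real.pi) ^ (-(n : ℝ)) := Real.rpow_nonneg Real.two_pi_pos.le _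
  set a : ℝ≥0∞ := ENNReal.ofReal ((2 * Real.pi) ^ (-(n : ℝ)) * C) * ENNReal.ofReal (1 / k ξ) with ha
  have ha' : a ≠ ⊤ := ENNReal.mul_ne_top ENNReal.ofReal_ne_top ENNReal.ofReal_ne_top
  have hv : v (testToSchwartz (modulate ξ (translateTest y φ))) = hatDist v θ := by
    rw [← hθ]
    rfl
  have hsob : eLpNorm (fun η => f (ξ - η)) 2 volume = sobolevNorm N φ := by
    rw [sobolevNorm, ← funext hf]
    exact eLpNorm_comp_measurePreserving f.continuous.aestronglyMeasurable
      (Measure.measurePreserving_sub_left volume ξ)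
  rw [hv]
  calc ‖hatDist v θ‖ₑ
    _ ≤ ∫⁻ η, ‖g η‖ₑ * ‖θ η‖ₑ := hg.enorm_apply_le θ
    _ ≤ ∫⁻ η, a * (‖(k η : ℂ) * g η‖ₑ * ‖f (ξ - η)‖ₑ) := by
      refine lintegral_mono fun η => ?_
      have hw : 1 ≤ C * (1 / k ξ) * k η * bracket (ξ - η) ^ N := by
        have := hCN.2.2 (ξ - η) η
        rw [sub_add_cancel] at this
        rw [mul_one_div, div_mul_eq_mul_div, div_mul_eq_mul_div, one_le_div (hk0 ξ)]
        linarith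
      have hw' : (1 : ℝ≥0∞) ≤ ENNReal.ofReal (C * (1 / k ξ)) * ‖(k η : ℂ)‖ₑ *
          ‖((bracket (ξ - η) ^ N : ℝ) : ℂ)‖ₑ := by
        have hb := Real.rpow_pos_of_pos (bracket_pos (ξ - η)) N
        have hC1 : 0 < C * (1 / k ξ) := mul_pos hCN.1 (one_div_pos.2 (hk0 ξ))
        rw [← ofReal_norm, ← ofReal_norm, Complex.norm_real, Complex.norm_real,
          Real.norm_of_nonneg hb.le, Real.norm_of_nonneg (hk0 η).le, ← ENNReal.ofReal_mul hC1.le,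
          ← ENNReal.ofReal_mul (mul_nonneg hC1.le (hk0 η).le), ← ENNReal.ofReal_one]
        exact ENNReal.ofReal_le_ofReal hw
      have hθn : ‖θ η‖ₑ = ENNReal.ofReal ((2 * Real.pi) ^ (-(n : ℝ))) *
          ‖∫ x, modulate (ξ - η) φ x‖ₑ := by
        rw [hθ', enorm_mul, enorm_integral_modulate_translateTest, ← ofReal_norm, Complex.norm_real,
          Real.norm_of_nonneg hpi]
      rw [hθn, hf, enorm_mul, enorm_mul, ha, ENNReal.ofReal_mul hpi]
      rw [ENNReal.ofReal_mul hCN.1.le] at hw'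
      refine (le_mul_of_one_le_left zero_le hw').trans (le_of_eq ?_)
      ring
    _ = a * ∫⁻ η, ‖(k η : ℂ) * g η‖ₑ * ‖f (ξ - η)‖ₑ := lintegral_const_mul' _ _ ha'
    _ ≤ a * (eLpNorm (fun η => (k η : ℂ) * g η) 2 volume * sobolevNorm N φ) := by
      gcongr
      rw [← hsob]
      refine lintegral_enorm_mul_le _ _ ?_ ?_
      · exact (Complex.measurable_ofReal.comp_aemeasurable hkm).aestronglyMeasurable.mul
          hg.1.aestronglyMeasurable
      · exact (f.continuous.comp (by fun_prop)).aestronglyMeasurable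
    _ = _ := by rw [ha]; ring

theorem mulTest_testToSchwartz (u : Distr n) (χ φ ψ : Test n) (h : ∀ x, ψ x = φ x * χ x) :
    mulTest u χ (testToSchwartz φ) = u ψ := by
  change u _ = u ψ
  congr 1
  ext x
  rw [h, mul_comm]
  rfl

theorem enorm_modulate_le_localNorm {k : Rn n → ℝ} (hkm : AEMeasurable k volume)
    (hk0 : ∀ ξ, 0 < k ξ) {C N : ℝ} (hCN : IsWeightBound k C N) (u : Distr n) {χ φ χ' : Test n}
    {a : Rn n} (h : ∀ x, χ x = φ x * χ' (x - a)) (y ξ : Rn n) :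
    ‖u (modulate ξ (translateTest y χ))‖ₑ ≤
      ENNReal.ofReal ((2 * Real.pi) ^ (-(n : ℝ)) * C) * sobolevNorm N φ *
        ENNReal.ofReal (1 / k ξ) * localNorm k u χ' (y + a) := by
  have hprod : mulTest u (translateTest (y + a) χ')
      (testToSchwartz (modulate ξ (translateTest y φ))) = u (modulate ξ (translateTest y χ)) := by
    refine mulTest_testToSchwartz _ _ _ _ fun x => ?_
    simp only [modulate_apply, translateTest_apply, h, mul_assoc, sub_sub]
  have hpi : (0 : ℝ) < (2 * Real.pi) ^ (-(n : ℝ)) := Real.rpow_pos_of_pos Real.two_pi_pos _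
  -- The infimum defining `bNorm` may run over an empty family and equal `∞`; a constant passes
  -- through it only when nonzero. If it vanishes, `φ = 0` and the left side is `0`.
  by_cases hφ : sobolevNorm N φ = 0
  · have hφ0 := eq_zero_of_sobolevNorm_eq_zero hφ
    have : modulate ξ (translateTest y χ) = 0 := by
      ext x
      simp [modulate_apply, translateTest_apply, h, hφ0]
    simp [this]
  · have h0 : ENNReal.ofReal ((2 * Real.pi) ^ (-(n : ℝ)) * C) * sobolevNorm N φ *
        ENNReal.ofReal (1 / k ξ) ≠ 0 :=
      mul_ne_zero (mul_ne_zero (ENNReal.ofReal_pos.2 (mul_pos hpi hCN.1)).ne' hφ)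
        (ENNReal.ofReal_pos.2 (one_div_pos.2 (hk0 ξ))).ne'
    have htop : ENNReal.ofReal ((2 * Real.pi) ^ (-(n : ℝ)) * C) * sobolevNorm N φ *
        ENNReal.ofReal (1 / k ξ) ≠ ⊤ :=
      ENNReal.mul_ne_top (ENNReal.mul_ne_top ENNReal.ofReal_ne_top (sobolevNorm_ne_top N φ))
        ENNReal.ofReal_ne_top
    rw [← hprod, localNorm, calBNorm, bNorm, ENNReal.mul_iInf_of_ne h0 htop]
    refine le_iInf fun g => ?_
    rw [ENNReal.mul_iInf_of_ne h0 htop]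
    exact le_iInf fun hg => hg.enorm_modulate_le hkm hk0 hCN φ y ξ

/-! ### Joint continuity in frequency and translation. -/

theorem contDiff_iteratedFDeriv_of_uncurry {P E F : Type*} [NormedAddCommGroup P]
    [NormedSpace ℝ P] [NormedAddCommGroup E] [NormedSpace ℝ E] [NormedAddCommGroup F]
    [NormedSpace ℝ F] {f : P → E → F} (hf : ContDiff ℝ ∞ (Function.uncurry f)) (i : ℕ) :
    ContDiff ℝ ∞ fun q : P × E => iteratedFDeriv ℝ i (f q.1) q.2 := by
  induction i with
  | zero =>
    simp only [iteratedFDeriv_zero_eq_comp, Function.comp_apply]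
    exact (continuousMultilinearCurryFin0 ℝ E F).symm.contDiff.comp hf
  | succ i ih =>
    simp only [iteratedFDeriv_succ_eq_comp_left, Function.comp_apply]
    have hD : ContDiff ℝ ∞ fun q : P × E => fderiv ℝ (iteratedFDeriv ℝ i (f q.1)) q.2 :=
      ContDiff.fderiv (m := ∞) (f := fun q : P × E => iteratedFDeriv ℝ i (f q.1))
        (ih.comp ((contDiff_fst.comp contDiff_fst).prodMk contDiff_snd)) contDiff_snd le_rfl
    exact (LinearIsometryEquiv.contDiff _).comp hD

/-- A jointly smooth family of functions supported in a fixed compact set is a continuous family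
of test functions. -/
theorem continuous_contDiffMapSupportedIn {P E F : Type*} [NormedAddCommGroup P]
    [NormedSpace ℝ P] [NormedAddCommGroup E] [NormedSpace ℝ E] [NormedAddCommGroup F]
    [NormedSpace ℝ F] {f : P → E → F} (hf : ContDiff ℝ ∞ (Function.uncurry f)) {U : Set P}
    {K : Compacts E} (ψ : U → 𝓓_{K}(E, F)) (hψ : ∀ p x, ψ p x = f p x) : Continuous ψ := by
  rw [ContDiffMapSupportedIn.continuous_iff_comp]
  refine fun i => continuous_iff_continuousAt.2 fun p₀ => ?_
  have hcont : Continuous fun q : U × E => iteratedFDeriv ℝ i (f q.1) q.2 :=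
    (contDiff_iteratedFDeriv_of_uncurry hf i).continuous.comp
      ((continuous_subtype_val.comp continuous_fst).prodMk continuous_snd)
  have he : ∀ p x, ContDiffMapSupportedIn.structureMapCLM ℝ ⊤ i (ψ p) x =
      iteratedFDeriv ℝ i (f p) x := fun p x => by
    rw [ContDiffMapSupportedIn.structureMapCLM_top_apply, ← funext (hψ p)]
  have hz : ∀ (p : U) x, x ∉ K → iteratedFDeriv ℝ i (f p) x = 0 := fun p x hx => by
    rw [← funext (hψ p)]
    exact (ψ p).iteratedFDeriv_zero_on_compl hx
  rw [ContinuousAt, BoundedContinuousFunction.tendsto_iff_tendstoUniformly,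
    Metric.tendstoUniformly_iff]
  intro ε hε
  -- Tube lemma: pointwise closeness on the compact `K` becomes uniform; off `K` both derivatives
  -- vanish.
  have hK := K.isCompact.eventually_forall_of_forall_eventually (x₀ := p₀)
    (P := fun p x => dist (iteratedFDeriv ℝ i (f p₀) x) (iteratedFDeriv ℝ i (f p) x) < ε)
    fun x _ => by
      have hc : Continuous fun z : U × E =>
          dist (iteratedFDeriv ℝ i (f p₀) z.2) (iteratedFDeriv ℝ i (f z.1) z.2) :=
        (hcont.comp (continuous_const.prodMk continuous_snd)).dist hcont
      exact hc.continuousAt.eventually_lt continuousAt_const (by simpa using hε)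
  filter_upwards [hK] with p hp x
  simp only [Function.comp_apply, he]
  by_cases hx : x ∈ K
  · exact hp x hx
  · rw [hz _ _ hx, hz _ _ hx, dist_self]
    exact hε

theorem continuous_apply_modulate_translateTest (u : Distr n) (χ : Test n) :
    Continuous fun q : Rn n × Rn n => u (modulate q.1 (translateTest q.2 χ)) := by
  refine continuous_iff_continuousAt.2 fun p₀ => ?_
  obtain ⟨R, hR⟩ := χ.hasCompactSupport.isBounded.subset_closedBall 0
  -- With `supp χ` in the ball of radius `R` and translations within `1` of `p₀.2`, all supports lie
  -- in this one ball.
  let K : Compacts (Rn n) := ⟨Metric.closedBall p₀.2 (R + 1), isCompact_closedBall _ _⟩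
  let U : Set (Rn n × Rn n) := {p | dist p.2 p₀.2 < 1}
  have hU : IsOpen U := isOpen_lt (by fun_prop) continuous_const
  have hsupp : ∀ p : U, Function.support (modulate p.1.1 (translateTest p.1.2 χ)) ⊆ K := by
    intro p x hx
    have hx' : χ (x - p.1.2) ≠ 0 := fun h => hx (by
      simp [modulate_apply, translateTest_apply, h])
    have h1 : ‖x - p.1.2‖ ≤ R := by simpa using hR (subset_tsupport _ hx')
    have h2 : dist p.1.2 p₀.2 < 1 := p.2
    change dist x p₀.2 ≤ R + 1
    have h3 := dist_triangle x p.1.2 p₀.2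
    rw [dist_eq_norm x p.1.2] at h3
    linarith
  let ψ : U → 𝓓_{K}(Rn n, ℂ) := fun p =>
    ContDiffMapSupportedIn.of_support_subset (modulate p.1.1 (translateTest p.1.2 χ)).contDiff
      (hsupp p)
  have hsm : ContDiff ℝ ∞ (Function.uncurry fun (p : Rn n × Rn n) (x : Rn n) =>
      Complex.exp (-(Complex.I * (inner ℝ x p.1 : ℝ))) * χ (x - p.2)) := by
    refine ContDiff.mul ?_ (χ.contDiff.comp (contDiff_snd.sub (contDiff_snd.comp contDiff_fst)))
    refine ContDiff.cexp (ContDiff.neg (contDiff_const.mul ?_))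
    exact Complex.ofRealCLM.contDiff.comp (contDiff_snd.inner ℝ (contDiff_fst.comp contDiff_fst))
  have hψ : Continuous ψ := continuous_contDiffMapSupportedIn hsm ψ fun p x => rfl
  have hc : Continuous fun p : U => u (modulate p.1.1 (translateTest p.1.2 χ)) :=
    u.continuous.comp ((TestFunction.continuous_ofSupportedIn
      (Ω := ⊤) (Set.subset_univ (K : Set (Rn n)))).comp hψ)
  exact (continuousOn_iff_continuous_domRestrict.2 hc).continuousAt (hU.mem_nhds (by simp [U]))

/-! ### Mixed norms and integration in frequency. -/

/-- For `p = ∞`, the bound by the essential supremum holds on a set that is closed and, having full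
measure, dense. -/
theorem mixedNorm_enorm_eq_eLpNorm {p : ℝ≥0∞} (hp : p ≠ 0) {f : Rn n → ℂ} (hf : Continuous f) :
    mixedNorm p (fun y => ‖f y‖ₑ) = eLpNorm f p volume := by
  rw [mixedNorm]
  split_ifs with h
  · rw [h, eLpNorm_exponent_top]
    refine le_antisymm (iSup_le fun y => ?_) (essSup_le_of_ae_le _ (Eventually.of_forall
      fun y => le_iSup (fun y => ‖f y‖ₑ) y))
    have hcl : IsClosed {y | ‖f y‖ₑ ≤ eLpNormEssSup f volume} :=
      isClosed_le hf.enorm continuous_const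
    have := (Measure.dense_of_ae (enorm_ae_le_eLpNormEssSup f volume)).closure_eq
    rw [hcl.closure_eq] at this
    exact (Set.ext_iff.1 this y).2 (Set.mem_univ y)
  · exact (eLpNorm_eq_lintegral_rpow_enorm_toReal hp h).symm

theorem bigU_eq_eLpNorm {p : ℝ≥0∞} (hp : p ≠ 0) (u : Distr n) (χ : Test n) (ξ : Rn n) :
    bigU p u χ ξ = eLpNorm (fun y => u (modulate ξ (translateTest y χ))) p volume := by
  have hc : Continuous fun y => u (modulate ξ (translateTest y χ)) :=
    Continuous.comp (g := fun q : Rn n × Rn n => u (modulate q.1 (translateTest q.2 χ)))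
      (f := fun y => (ξ, y)) (continuous_apply_modulate_translateTest u χ)
      (Continuous.prodMk_right ξ)
  rw [bigU, mixedNorm_enorm_eq_eLpNorm hp hc]

theorem eLpNorm_le_mixedNorm {p : ℝ≥0∞} (hp : p ≠ 0) (f : Rn n → ℝ≥0∞) :
    eLpNorm f p volume ≤ mixedNorm p f := by
  rw [mixedNorm]
  split_ifs with h
  · rw [h, eLpNorm_exponent_top]
    exact essSup_le_of_ae_le _ (Eventually.of_forall fun y => le_iSup f y)
  · rw [eLpNorm_eq_lintegral_rpow_enorm_toReal hp h]
    simp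

theorem measurable_bigU (p : ℝ≥0∞) (u : Distr n) (χ : Test n) : Measurable (bigU p u χ) := by
  have hc := continuous_apply_modulate_translateTest u χ
  unfold bigU mixedNorm
  split_ifs with h
  · refine LowerSemicontinuous.measurable (lowerSemicontinuous_iSup fun y => ?_)
    exact (hc.comp (Continuous.prodMk_left y)).enorm.lowerSemicontinuous
  · refine Measurable.pow_const ?_ _
    exact Measurable.lintegral_prod_right' (f := fun q : Rn n × Rn n =>
      ‖u (modulate q.1 (translateTest q.2 χ))‖ₑ ^ p.toReal) (hc.enorm.measurable.pow_const _)

/-- The bound uses `eLpNorm` rather than `normB` because for `p = ∞` the condition `MemB` controls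
only the essential supremum of `localNorm`. -/
theorem normSw_le_of_eq_mul {k : Rn n → ℝ} (hkm : AEMeasurable k volume) (hk0 : ∀ ξ, 0 < k ξ)
    {C N : ℝ} (hCN : IsWeightBound k C N) {p : ℝ≥0∞} (hp : p ≠ 0) (u : Distr n)
    {χ φ χ' : Test n} {a : Rn n} (h : ∀ x, χ x = φ x * χ' (x - a)) :
    normSw p χ u ≤ ENNReal.ofReal ((2 * Real.pi) ^ (-(n : ℝ)) * C) * sobolevNorm N φ *
      (∫⁻ ξ, ENNReal.ofReal (1 / k ξ)) * eLpNorm (localNorm k u χ') p volume := by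
  set c : ℝ≥0∞ := ENNReal.ofReal ((2 * Real.pi) ^ (-(n : ℝ)) * C) * sobolevNorm N φ with hc
  have hctop : c ≠ ⊤ := ENNReal.mul_ne_top ENNReal.ofReal_ne_top (sobolevNorm_ne_top N φ)
  have hshift : eLpNorm (fun y => localNorm k u χ' (y + a)) p volume =
      eLpNorm (localNorm k u χ') p volume := by
    have := (measurableEmbedding_addRight a).eLpNorm_map_measure (μ := (volume : Measure (Rn n)))
      (g := localNorm k u χ') (p := p)
    rw [map_add_right_eq_self] at this
    exact this.symm
  have hU : ∀ ξ, bigU p u χ ξ ≤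
      c * ENNReal.ofReal (1 / k ξ) * eLpNorm (localNorm k u χ') p volume := fun ξ => by
    have hctop' : c * ENNReal.ofReal (1 / k ξ) ≠ ⊤ :=
      ENNReal.mul_ne_top hctop ENNReal.ofReal_ne_top
    rw [bigU_eq_eLpNorm hp, ← hshift, ← ENNReal.coe_toNNReal hctop']
    refine eLpNorm_le_mul_eLpNorm_of_ae_le_mul' (Eventually.of_forall fun y => ?_) p
    rw [ENNReal.coe_toNNReal hctop', enorm_eq_self]
    exact enorm_modulate_le_localNorm hkm hk0 hCN u h y ξ
  have hm : AEMeasurable (fun ξ => ENNReal.ofReal (1 / k ξ)) volume :=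
    (hkm.const_div 1).ennreal_ofReal
  calc normSw p χ u
    _ ≤ ∫⁻ ξ, c * ENNReal.ofReal (1 / k ξ) * eLpNorm (localNorm k u χ') p volume :=
      lintegral_mono hU
    _ = _ := by rw [lintegral_mul_const'' _ (hm.const_mul c), lintegral_const_mul' _ _ hctop]

/-! ### Change of window. -/

theorem sum_test_apply {ι : Type*} (t : Finset ι) (f : ι → Test n) (x : Rn n) :
    (∑ a ∈ t, f a) x = ∑ a ∈ t, f a x := by
  classical
  induction t using Finset.induction_on with
  | empty => rfl
  | insert a t ha ih =>
    rw [Finset.sum_insert ha, Finset.sum_insert ha, ← ih]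
    rfl

theorem normSw_le_sum {p : ℝ≥0∞} (hp : 1 ≤ p) (u : Distr n) {ι : Type*} (t : Finset ι)
    (f : ι → Test n) : normSw p (∑ a ∈ t, f a) u ≤ ∑ a ∈ t, normSw p (f a) u := by
  have hp0 : p ≠ 0 := (zero_lt_one.trans_le hp).ne'
  have hU : ∀ ξ, bigU p u (∑ a ∈ t, f a) ξ ≤ ∑ a ∈ t, bigU p u (f a) ξ := fun ξ => by
    have he : (fun y => u (modulate ξ (translateTest y (∑ a ∈ t, f a)))) =
        ∑ a ∈ t, fun y => u (modulate ξ (translateTest y (f a))) := by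
      ext y
      rw [Finset.sum_apply, ← map_sum]
      congr 1
      ext x
      simp only [modulate_apply, translateTest_apply, sum_test_apply, Finset.mul_sum]
    simp only [bigU_eq_eLpNorm hp0]
    rw [he]
    refine eLpNorm_sum_le (fun a _ => ?_) hp
    exact (Continuous.comp (g := fun q : Rn n × Rn n => u (modulate q.1 (translateTest q.2 (f a))))
      (f := fun y => (ξ, y)) (continuous_apply_modulate_translateTest u (f a))
      (Continuous.prodMk_right ξ)).aestronglyMeasurable
  calc normSw p (∑ a ∈ t, f a) u
    _ ≤ ∫⁻ ξ, ∑ a ∈ t, bigU p u (f a) ξ := lintegral_mono hU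
    _ = _ := lintegral_finsetSum _ fun a _ => measurable_bigU p u (f a)

/-- The product of two test functions, the second one translated. -/
def mulTranslate (φ χ : Test n) (a : Rn n) : Test n where
  toFun x := φ x * χ (x - a)
  contDiff' := φ.contDiff.mul (translateTest a χ).contDiff
  hasCompactSupport' := φ.hasCompactSupport.mul_right
  tsupport_subset' := Set.subset_univ _

/-- Every test function is a finite combination of translates of a given nonzero one, with test
functions as coefficients. -/
theorem exists_eq_sum_mulTranslate (χ χ' : Test n) (h : χ' ≠ 0) :
    ∃ (t : Finset (Rn n)) (φ : Rn n → Test n), χ = ∑ a ∈ t, mulTranslate (φ a) χ' a := by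
  obtain ⟨x₀, hx₀⟩ : ∃ x, χ' x ≠ 0 := by
    by_contra! hc
    exact h (TestFunction.ext hc)
  obtain ⟨t, ht⟩ := χ.hasCompactSupport.isCompact.elim_finite_subcover
    (fun a : Rn n => {x | χ' (x - a) ≠ 0})
    (fun a => isOpen_ne_fun (χ'.continuous.comp (by fun_prop)) continuous_const)
    fun x _ => Set.mem_iUnion.2 ⟨x - x₀, by simpa using hx₀⟩
  -- Conjugates make `Ψ = ∑ |χ'(· - a)|²`, which is positive on `supp χ` by the choice of cover; the
  -- coefficients are then `χ · w a / Ψ`.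
  let w : Rn n → Rn n → ℂ := fun a x => star (χ' (x - a))
  let Ψ : Rn n → ℂ := fun x => ∑ a ∈ t, w a x * χ' (x - a)
  have hχs : ∀ a, ContDiff ℝ ∞ fun x => χ' (x - a) := fun a => (translateTest a χ').contDiff
  have hw : ∀ a, ContDiff ℝ ∞ (w a) := fun a =>
    (starL' ℝ : ℂ ≃L[ℝ] ℂ).contDiff.comp (hχs a)
  have hΨ : ContDiff ℝ ∞ Ψ := ContDiff.sum fun a _ => (hw a).mul (hχs a)
  have hΨ0 : ∀ x ∈ tsupport χ, Ψ x ≠ 0 := by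
    intro x hx hzero
    obtain ⟨a, hmem, ha⟩ : ∃ a ∈ t, χ' (x - a) ≠ 0 := by simpa using ht hx
    have hsum : Ψ x = ((∑ a ∈ t, Complex.normSq (χ' (x - a)) : ℝ) : ℂ) := by
      rw [Complex.ofReal_sum]
      exact Finset.sum_congr rfl fun a _ => (Complex.normSq_eq_conj_mul_self).symm
    rw [hsum, Complex.ofReal_eq_zero,
      Finset.sum_eq_zero_iff_of_nonneg fun a _ => Complex.normSq_nonneg _] at hzero
    exact ha (Complex.normSq_eq_zero.1 (hzero a hmem))
  have hsmooth : ∀ a, ContDiff ℝ ∞ fun x => χ x * (w a x * (Ψ x)⁻¹) := by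
    refine fun a => contDiff_iff_contDiffAt.2 fun x => ?_
    -- `Ψ` may vanish away from `supp χ`, but there the quotient is locally zero because of the
    -- factor `χ`.
    by_cases hx : x ∈ tsupport χ
    · exact χ.contDiff.contDiffAt.mul ((hw a).contDiffAt.mul (hΨ.contDiffAt.inv (hΨ0 x hx)))
    · have hev : (fun x => χ x * (w a x * (Ψ x)⁻¹)) =ᶠ[𝓝 x] fun _ => 0 := by
        filter_upwards [notMem_tsupport_iff_eventuallyEq.1 hx] with z hz
        simp [hz]
      exact contDiffAt_const.congr_of_eventuallyEq hev
  refine ⟨t, fun a => ⟨fun x => χ x * (w a x * (Ψ x)⁻¹), hsmooth a, χ.hasCompactSupport.mul_right,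
    Set.subset_univ _⟩, ?_⟩
  ext x
  rw [sum_test_apply]
  change χ x = ∑ a ∈ t, χ x * (w a x * (Ψ x)⁻¹) * χ' (x - a)
  by_cases hx : x ∈ tsupport χ
  · have : ∀ a, χ x * (w a x * (Ψ x)⁻¹) * χ' (x - a) = χ x / Ψ x * (w a x * χ' (x - a)) :=
      fun a => by ring
    simp only [this, ← Finset.mul_sum]
    exact (div_mul_cancel₀ _ (hΨ0 x hx)).symm
  · simp [image_eq_zero_of_notMem_tsupport hx]

theorem exists_normSw_le {k : Rn n → ℝ} (hk : IsPolWeight k)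
    (hk1 : Integrable (fun ξ => 1 / k ξ) volume) {p : ℝ≥0∞} (hp : 1 ≤ p) (χ χ' : Test n)
    (hχ' : χ' ≠ 0) :
    ∃ A : NNReal, ∀ u : Distr n, normSw p χ u ≤ A * eLpNorm (localNorm k u χ') p volume := by
  obtain ⟨hkm, hk0, C, N, hCN⟩ := hk
  obtain ⟨t, φ, hφ⟩ := exists_eq_sum_mulTranslate χ χ' hχ'
  have hI : ∫⁻ ξ, ENNReal.ofReal (1 / k ξ) ≠ ⊤ := hk1.lintegral_lt_top.ne
  have hA : ∑ a ∈ t, ENNReal.ofReal ((2 * Real.pi) ^ (-(n : ℝ)) * C) * sobolevNorm N (φ a) *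
      (∫⁻ ξ, ENNReal.ofReal (1 / k ξ)) ≠ ⊤ :=
    ENNReal.sum_ne_top.2 fun a _ => ENNReal.mul_ne_top
      (ENNReal.mul_ne_top ENNReal.ofReal_ne_top (sobolevNorm_ne_top N (φ a))) hI
  refine ⟨(∑ a ∈ t, ENNReal.ofReal ((2 * Real.pi) ^ (-(n : ℝ)) * C) * sobolevNorm N (φ a) *
      (∫⁻ ξ, ENNReal.ofReal (1 / k ξ))).toNNReal, fun u => ?_⟩
  rw [ENNReal.coe_toNNReal hA, Finset.sum_mul, hφ]
  exact (normSw_le_sum hp u t _).trans (Finset.sum_le_sum fun a _ =>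
    normSw_le_of_eq_mul hkm hk0 hCN (zero_lt_one.trans_le hp).ne' u fun _ => rfl)

end KatoSobolev

end

open KatoSobolev

theorem mainTheorem9 (n : ℕ) (k : Rn n → ℝ) (hk : IsPolWeight k)
    (hk1 : Integrable (fun ξ => 1 / k ξ) volume) (p : ℝ≥0∞) (hp : 1 ≤ p) :
    (∀ u : Distr n, MemB k p u → MemSw p u) ∧
    (∀ χ χ' : Test n, χ ≠ 0 → χ' ≠ 0 →
      ∃ A : NNReal, ∀ u : Distr n, MemB k p u → normSw p χ u ≤ A * normB k p χ' u) ∧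
    (∀ C N : ℝ, IsWeightBound k C N →
      ∀ χ χ' : Test n, χ ≠ 0 → (∀ x ∈ tsupport χ, χ' x = 1) →
      ∀ u : Distr n, MemB k p u →
        normSw p χ u ≤ ENNReal.ofReal ((2 * Real.pi) ^ (-(n : ℝ)) * C) * sobolevNorm N χ *
          (∫⁻ ξ, ENNReal.ofReal (1 / k ξ)) * normB k p χ' u) := by
  have hp0 : p ≠ 0 := (zero_lt_one.trans_le hp).ne'
  refine ⟨?_, fun χ χ' _ hχ' => ?_, fun C N hCN χ χ' _ hχχ' u _ => ?_⟩
  · rintro u ⟨χ, hχ, hmem⟩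
    -- The window is compared with itself: integrability is known for this `χ` only.
    obtain ⟨A, hA⟩ := exists_normSw_le hk hk1 hp χ χ hχ
    refine ⟨χ, hχ, (measurable_bigU p u χ).aestronglyMeasurable, ?_⟩
    rw [eLpNorm_one_eq_lintegral_enorm]
    simp only [enorm_eq_self]
    exact (hA u).trans_lt (ENNReal.mul_lt_top ENNReal.coe_lt_top hmem.2)
  · obtain ⟨A, hA⟩ := exists_normSw_le hk hk1 hp χ χ' hχ'
    exact ⟨A, fun u _ => (hA u).trans (mul_le_mul_right (eLpNorm_le_mixedNorm hp0 _) _)⟩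
  · have hprod : ∀ x, χ x = χ x * χ' (x - 0) := fun x => by
      by_cases hx : x ∈ tsupport χ
      · rw [sub_zero, hχχ' x hx, mul_one]
      · rw [image_eq_zero_of_notMem_tsupport hx, zero_mul]
    exact (normSw_le_of_eq_mul hk.1 hk.2.1 hCN hp0 u hprod).trans
      (mul_le_mul_right (eLpNorm_le_mixedNorm hp0 _) _)
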